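/- Let $n\ge 1$ and let $K\colon\mathbb{R}^n\to[0,+\infty]$ be measurable and not a.e. equal to $0$. Assume that: * (Rad) $K(x)=\kappa(|x|)$ for all $x\in\mathbb{R}^n$, for some measurable $\kappa\colon[0,+\infty)\to[0,+\infty]$; * (Nts) $\int_{\mathbb{R}^n}\min\{1,|x|\}\,K(x)\,dx<+\infty$; * (Nint) $K\notin L^1(\mathbb{R}^n)$; * (Dec$_1$) $K(y)\,|y|\le K(x)\,|x|$ whenever $0<|x|\le|y|$; * (Dou$_D$) for some $D\in(0,+\infty]$ there is $C\in(0,+\infty)$ such that $K(x)\le C\,K(y)$ whenever $|y|=2|x|$ and $|x|\le 2D$. For $w\in L^\infty(\mathbb{R}^n)$ with $\operatorname{ess\,inf} w>0$ put $\nu=w\,\mathcal{L}^n$ and $\overline w=\operatorname{ess\,sup} w$. For $f\in L^1(\mathbb{R}^n)$ and $\Lambda>0$, let $\mathrm{Sol}(f,\Lambda,\nu)$ be the set of all $u\in L^1_{\mathrm{loc}}(\mathbb{R}^n)$ which minimize $$ \mathcal{E}(u)=\frac12\int_{\mathbb{R}^n}\int_{\mathbb{R}^n}|u(x)-u(y)|\,K(x-y)\,dx\,dy+\Lambda\int_{\mathbb{R}^n}|u-f|\,d\nu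 $$ over $L^1_{\mathrm{loc}}(\mathbb{R}^n)$ and satisfy $\mathcal{E}(u)<+\infty$, functions being identified when they agree a.e. Theorem (Low fidelity). For every $0<R<D/4$ there exists $\Lambda_{R,K,\overline w}>0$, depending only on $R$, $K$ and $\overline w$, such that, for every $w$ as above with essential supremum $\overline w$, every $f\in L^1(\mathbb{R}^n)$ which vanishes a.e. outside the ball $B_R$ centred at the origin (in particular, every $f\in L^1(\mathbb{R}^n)$ with $\operatorname{supp} f\subset B_R$), and every $0<\Lambda<\Lambda_{R,K,\overline w}$, $$ \mathrm{Sol}(f,\Lambda,\nu)=\{0\}. $$ -/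

import Mathlib

open MeasureTheory
open scoped ENNReal NNReal

namespace NonlocalTV

variable {n : ℕ}

/-- A kernel on `ℝⁿ`: a measurable function with values in `[0,+∞]` which is not a.e. zero. -/
structure IsKernel (K : EuclideanSpace ℝ (Fin n) → ℝ≥0∞) : Prop where
  measurable : Measurable K
  not_ae_zero : ¬ K =ᵐ[volume] 0

/-- (Rad): `K x = κ |x|` for a measurable profile `κ : [0,+∞) → [0,+∞]`. -/
def Radial (K : EuclideanSpace ℝ (Fin n) → ℝ≥0∞) : Prop :=
  ∃ κ : ℝ≥0 → ℝ≥0∞, Measurable κ ∧ ∀ x, K x = κ ‖x‖₊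

/-- (Nts): `∫ (1 ∧ |x|) K(x) dx < +∞`. -/
def NotTooSingular (K : EuclideanSpace ℝ (Fin n) → ℝ≥0∞) : Prop :=
  ∫⁻ x, min 1 ‖x‖ₑ * K x < ∞

/-- (Nint): `K ∉ L¹(ℝⁿ)`. -/
def NotIntegrable (K : EuclideanSpace ℝ (Fin n) → ℝ≥0∞) : Prop :=
  ¬ ∫⁻ x, K x < ∞

/-- (Dec_q): `K(y) |y|^q ≤ K(x) |x|^q` whenever `|x| ≤ |y|`. The point `x = 0` is left out: there
the right-hand side is the undetermined product of `K(0)`, typically `+∞`, with `0`. -/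
def Decreasing (q : ℝ≥0) (K : EuclideanSpace ℝ (Fin n) → ℝ≥0∞) : Prop :=
  ∀ x y, x ≠ 0 → ‖x‖ ≤ ‖y‖ → K y * ‖y‖ₑ ^ (q : ℝ) ≤ K x * ‖x‖ₑ ^ (q : ℝ)

/-- (Dou_D), for `D ∈ (0,+∞]`: there is a finite `C > 0` with `K(x) ≤ C K(y)` whenever
`|y| = 2 |x|` and `|x| ≤ 2 D`. -/
def Doubling (D : ℝ≥0∞) (K : EuclideanSpace ℝ (Fin n) → ℝ≥0∞) : Prop :=
  ∃ C : ℝ≥0, 0 < C ∧ ∀ x y, ‖y‖ = 2 * ‖x‖ → ‖x‖ₑ ≤ 2 * D → K x ≤ C * K y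

/-- The `K`-variation `½ ∫∫ |u(x) - u(y)| K(x - y) dx dy`. -/
noncomputable def kerVariation (K : EuclideanSpace ℝ (Fin n) → ℝ≥0∞)
    (u : EuclideanSpace ℝ (Fin n) → ℝ) : ℝ≥0∞ :=
  2⁻¹ * ∫⁻ y, ∫⁻ x, ‖u x - u y‖ₑ * K (x - y)

/-- The densities of admissible weight measures: `w ∈ L^∞(ℝⁿ)` with `ess inf w > 0`. -/
def AdmissibleDensity (w : EuclideanSpace ℝ (Fin n) → ℝ) : Prop :=
  MemLp w ∞ volume ∧ 0 < essInf w volume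

/-- The measure `ν = w 𝓛ⁿ`. -/
noncomputable def weightMeasure (w : EuclideanSpace ℝ (Fin n) → ℝ) :
    Measure (EuclideanSpace ℝ (Fin n)) :=
  volume.withDensity fun x ↦ ENNReal.ofReal (w x)

/-- The functional energy `[u]_{BV^K} + Λ ∫ |u - f| dν`. -/
noncomputable def energy (K : EuclideanSpace ℝ (Fin n) → ℝ≥0∞)
    (f : EuclideanSpace ℝ (Fin n) → ℝ) (Λ : ℝ) (ν : Measure (EuclideanSpace ℝ (Fin n)))
    (u : EuclideanSpace ℝ (Fin n) → ℝ) : ℝ≥0∞ :=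
  kerVariation K u + ENNReal.ofReal Λ * ∫⁻ x, ‖u x - f x‖ₑ ∂ν

/-- The solutions of the functional problem: the minimizers of the energy, with finite energy,
among all `L¹_loc(ℝⁿ)` functions. (This is a set of functions closed under a.e. equality.) -/
def solutions (K : EuclideanSpace ℝ (Fin n) → ℝ≥0∞)
    (f : EuclideanSpace ℝ (Fin n) → ℝ) (Λ : ℝ) (ν : Measure (EuclideanSpace ℝ (Fin n))) :
    Set (EuclideanSpace ℝ (Fin n) → ℝ) :=
  {u | LocallyIntegrable u volume ∧ energy K f Λ ν u < ∞ ∧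
    ∀ v, LocallyIntegrable v volume → energy K f Λ ν u ≤ energy K f Λ ν v}

end NonlocalTV

open MeasureTheory
open scoped ENNReal NNReal

namespace NonlocalTV

section

variable {n : ℕ} {K : EuclideanSpace ℝ (Fin n) → ℝ≥0∞} {u f : EuclideanSpace ℝ (Fin n) → ℝ}

open Metric Filter Topology

/-! If `2 * R ≤ ‖h‖`, the balls of radius `R` centred at `0, h, 2h, …` are disjoint. Telescoping an
integrable `u` along them bounds its mass in the first ball by `∫ |u(x + h) - u(x)| dx`
(`setLIntegral_ball_le_lintegral_increment`). Integrating against `K` over such `h` gives a Poincaré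
inequality with constant `c = ½ ∫_{|h| ≥ 2R} K`, positive by doubling and monotonicity
(`setLIntegral_kernel_pos`).

Since `f` vanishes off the ball, replacing `u` by `0` raises the fidelity by at most `Λ * essSup w`
times the mass of `u` in the ball, and saves the mass outside. The variation saved is at least `c`
times the mass inside, so `0` is the only minimizer once `Λ * essSup w < c` (`energy_zero_add_le`).
-/

/-! ### Increments along disjoint translates of a ball, and the Poincaré inequality. -/

lemma pairwise_disjoint_ball_smul {E : Type*} [NormedAddCommGroup E] [NormedSpace ℝ E] {h : E}
    {R : ℝ} (hh : 2 * R ≤ ‖h‖) : Pairwise (Function.onFun Disjoint fun k : ℕ ↦ ball ((k : ℝ) • h) R) := by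
  intro i j hij
  apply ball_disjoint_ball
  rw [dist_eq_norm, ← sub_smul, norm_smul, Real.norm_eq_abs]
  have h1 : (1 : ℝ) ≤ |(i : ℝ) - j| := by
    have : (1 : ℤ) ≤ |(i : ℤ) - j| := Int.one_le_abs (by omega)
    exact_mod_cast this
  nlinarith [norm_nonneg h]

lemma setLIntegral_ball_add_right (g : EuclideanSpace ℝ (Fin n) → ℝ≥0∞)
    (v : EuclideanSpace ℝ (Fin n)) (R : ℝ) :
    ∫⁻ x in ball 0 R, g (x + v) = ∫⁻ x in ball v R, g x := by
  rw [← lintegral_indicator measurableSet_ball, ← lintegral_indicator measurableSet_ball,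
    ← lintegral_add_right_eq_self (μ := volume) ((ball v R).indicator g) v]
  congr 1 with x
  simp only [Set.indicator, mem_ball, dist_eq_norm, sub_zero, add_sub_cancel_right]

lemma tsum_setLIntegral_ball_smul_le {h : EuclideanSpace ℝ (Fin n)} {R : ℝ} (hh : 2 * R ≤ ‖h‖)
    (g : EuclideanSpace ℝ (Fin n) → ℝ≥0∞) :
    ∑' k : ℕ, ∫⁻ x in ball 0 R, g (x + (k : ℝ) • h) ≤ ∫⁻ x, g x := by
  simp_rw [setLIntegral_ball_add_right]
  rw [← lintegral_iUnion (fun _ ↦ measurableSet_ball) (pairwise_disjoint_ball_smul hh)]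
  exact setLIntegral_le_lintegral _ _

/-- The mass of an integrable function in a ball is controlled by its increments along any vector
whose length is at least the diameter of the ball. -/
lemma setLIntegral_ball_le_lintegral_increment {h : EuclideanSpace ℝ (Fin n)} {R : ℝ}
    (hh : 2 * R ≤ ‖h‖) (hum : Measurable u) (hu : ∫⁻ x, ‖u x‖ₑ ≠ ∞) :
    ∫⁻ x in ball 0 R, ‖u x‖ₑ ≤ ∫⁻ x, ‖u (x + h) - u x‖ₑ := by
  have key (N : ℕ) : ∫⁻ x in ball 0 R, ‖u x‖ₑ ≤
      (∑ k ∈ Finset.range N, ∫⁻ x in ball 0 R, ‖u (x + (k : ℝ) • h + h) - u (x + (k : ℝ) • h)‖ₑ)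
        + ∫⁻ x in ball 0 R, ‖u (x + (N : ℝ) • h)‖ₑ := by
    induction N with
    | zero => simp
    | succ N ih =>
      refine ih.trans ?_
      rw [Finset.sum_range_succ, add_assoc]
      gcongr
      rw [← lintegral_add_left (by fun_prop)]
      refine lintegral_mono fun x ↦ ?_
      have e : x + ((N + 1 : ℕ) : ℝ) • h = x + (N : ℝ) • h + h := by
        push_cast; rw [add_smul, one_smul, add_assoc]
      simp only [e]
      simpa only [sub_sub_cancel, add_comm] using enorm_sub_le (a := u (x + (N : ℝ) • h + h))
        (b := u (x + (N : ℝ) • h + h) - u (x + (N : ℝ) • h))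
  -- The remainders are terms of a convergent series, being integrals of `|u|` over disjoint balls,
  -- so they tend to zero.
  have hlim : Tendsto (fun N : ℕ ↦ (∫⁻ x, ‖u (x + h) - u x‖ₑ)
      + ∫⁻ x in ball 0 R, ‖u (x + (N : ℝ) • h)‖ₑ) atTop (𝓝 ((∫⁻ x, ‖u (x + h) - u x‖ₑ) + 0)) :=
    tendsto_const_nhds.add <| ENNReal.tendsto_atTop_zero_of_tsum_ne_top <|
      ne_top_of_le_ne_top hu (tsum_setLIntegral_ball_smul_le hh fun x ↦ ‖u x‖ₑ)
  rw [add_zero] at hlim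
  refine ge_of_tendsto' hlim fun N ↦ (key N).trans ?_
  gcongr
  exact (ENNReal.sum_le_tsum _).trans
    (tsum_setLIntegral_ball_smul_le hh fun x ↦ ‖u (x + h) - u x‖ₑ)

lemma kerVariation_congr_ae {v : EuclideanSpace ℝ (Fin n) → ℝ} (h : u =ᵐ[volume] v) :
    kerVariation K u = kerVariation K v := by
  unfold kerVariation
  congr 1
  refine lintegral_congr_ae (h.mono fun y hy ↦ lintegral_congr_ae (h.mono fun x hx ↦ ?_))
  simp only [hx, hy]

lemma kerVariation_eq_lintegral_increment (hK : Measurable K) (hu : Measurable u) :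
    kerVariation K u = 2⁻¹ * ∫⁻ h, K h * ∫⁻ x, ‖u (x + h) - u x‖ₑ := by
  unfold kerVariation
  congr 1
  calc ∫⁻ y, ∫⁻ x, ‖u x - u y‖ₑ * K (x - y)
      = ∫⁻ y, ∫⁻ h, ‖u (y + h) - u y‖ₑ * K h := by
        congr 1 with y
        rw [← lintegral_add_left_eq_self (μ := volume) _ y]
        simp
    _ = ∫⁻ h, ∫⁻ y, ‖u (y + h) - u y‖ₑ * K h :=
        lintegral_lintegral_swap (by unfold Function.uncurry; fun_prop)
    _ = ∫⁻ h, K h * ∫⁻ x, ‖u (x + h) - u x‖ₑ := by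
        congr 1 with h
        rw [lintegral_mul_const _ (by fun_prop), mul_comm]

/-- A Poincaré inequality: the `K`-variation controls the mass in a ball, with constant the mass of
the kernel at distances at least the diameter of the ball. -/
lemma lintegral_kernel_mul_setLIntegral_ball_le_kerVariation (hK : Measurable K)
    (hu : Integrable u volume) (R : ℝ) :
    2⁻¹ * (∫⁻ h in {h | 2 * R ≤ ‖h‖}, K h) * ∫⁻ x in ball 0 R, ‖u x‖ₑ ≤ kerVariation K u := by
  obtain ⟨v, hv, huv⟩ := hu.aestronglyMeasurable.aemeasurable
  have hvi : ∫⁻ x, ‖v x‖ₑ ≠ ∞ := (hu.congr huv).2.ne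
  have e : ∫⁻ x in ball 0 R, ‖u x‖ₑ = ∫⁻ x in ball 0 R, ‖v x‖ₑ :=
    lintegral_congr_ae (ae_restrict_of_ae (huv.mono fun x hx ↦ by simp only [hx]))
  rw [kerVariation_congr_ae huv, e, kerVariation_eq_lintegral_increment hK hv, mul_assoc]
  gcongr
  rw [← lintegral_mul_const _ hK]
  refine le_trans ?_ (setLIntegral_le_lintegral {h | 2 * R ≤ ‖h‖} _)
  refine setLIntegral_mono_ae' (measurableSet_le measurable_const measurable_norm) (.of_forall ?_)
  intro h hh
  exact mul_le_mul_right (setLIntegral_ball_le_lintegral_increment hh hv hvi) _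

/-! ### Positivity of the tail of the kernel. -/

lemma Decreasing.pos_of_norm_le {q : ℝ≥0} (hDec : Decreasing q K) {x y : EuclideanSpace ℝ (Fin n)}
    (hx : x ≠ 0) (hxy : ‖x‖ ≤ ‖y‖) (hy : 0 < K y) : 0 < K x := by
  refine pos_iff_ne_zero.2 fun h0 ↦ ?_
  have h := hDec x y hx hxy
  rw [h0, zero_mul, nonpos_iff_eq_zero, mul_eq_zero] at h
  have hy0 : 0 < ‖y‖ := (norm_pos_iff.2 hx).trans_le hxy
  rcases h with h | h
  · exact hy.ne' h
  · refine (ENNReal.rpow_pos (p := (q : ℝ)) (x := ‖y‖ₑ) ?_ enorm_ne_top).ne' h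
    exact enorm_pos.2 (norm_pos_iff.1 hy0)

/-- A doubling kernel charges points beyond any radius in the doubling range. -/
lemma Doubling.exists_pos_of_lt_norm {D : ℝ≥0∞} (hDou : Doubling D K) {r : ℝ}
    (hr : ENNReal.ofReal r ≤ 2 * D) {x : EuclideanSpace ℝ (Fin n)} (hx : x ≠ 0) (hKx : 0 < K x) :
    ∃ z, r < ‖z‖ ∧ 0 < K z := by
  obtain ⟨C, -, hC⟩ := hDou
  by_contra! hcon
  -- If `K` vanished beyond radius `r`, every point where `K` is positive would lie in the doubling
  -- range, so positivity would propagate to all `2 ^ k • x`, which are unbounded.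
  have pos (k : ℕ) : 0 < K ((2 : ℝ) ^ k • x) := by
    induction k with
    | zero => simpa
    | succ k ih =>
      refine pos_iff_ne_zero.2 fun h0 ↦ ih.ne' ?_
      have hle : ‖(2 : ℝ) ^ k • x‖ ≤ r := not_lt.1 fun hlt ↦ ih.ne' (nonpos_iff_eq_zero.1 (hcon _ hlt))
      have := hC ((2 : ℝ) ^ k • x) ((2 : ℝ) ^ (k + 1) • x)
        (by rw [pow_succ', mul_smul, norm_smul (2 : ℝ)]; simp)
        (by rw [← ofReal_norm]; exact (ENNReal.ofReal_le_ofReal hle).trans hr)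
      simpa [h0] using this
  obtain ⟨k, hk⟩ := pow_unbounded_of_one_lt (r / ‖x‖) (one_lt_two (α := ℝ))
  rw [div_lt_iff₀ (norm_pos_iff.2 hx)] at hk
  refine (pos k).ne' (nonpos_iff_eq_zero.1 (hcon _ ?_))
  rwa [norm_smul, norm_pow, Real.norm_two]

/-- Doubling yields one point `z` beyond radius `r` with `K z > 0`; monotonicity spreads positivity
to the nonempty open annulus `r < ‖h‖ < ‖z‖`, which has positive measure. -/
lemma setLIntegral_kernel_pos (hn : 1 ≤ n) (hK : IsKernel K) {q : ℝ≥0} (hDec : Decreasing q K)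
    {D : ℝ≥0∞} (hDou : Doubling D K) {r : ℝ} (hr : 0 < r) (hrD : ENNReal.ofReal r ≤ 2 * D) :
    0 < ∫⁻ h in {h | r ≤ ‖h‖}, K h := by
  have : Nonempty (Fin n) := ⟨⟨0, hn⟩⟩
  obtain ⟨x, hx, hKx⟩ : ∃ x, x ≠ 0 ∧ 0 < K x := by
    by_contra! hcon
    refine hK.not_ae_zero ?_
    filter_upwards [compl_mem_ae_iff.2 (measure_singleton (0 : EuclideanSpace ℝ (Fin n)))] with x hx
    exact nonpos_iff_eq_zero.1 (hcon x hx)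
  obtain ⟨z, hrz, hKz⟩ := hDou.exists_pos_of_lt_norm hrD hx hKx
  set U : Set (EuclideanSpace ℝ (Fin n)) := {h | r < ‖h‖ ∧ ‖h‖ < ‖z‖}
  have hU : IsOpen U :=
    (isOpen_lt continuous_const continuous_norm).inter (isOpen_lt continuous_norm continuous_const)
  have hUne : U.Nonempty := by
    obtain ⟨s, hrs, hsz⟩ := exists_between hrz
    obtain ⟨y, hy⟩ := exists_norm_eq (EuclideanSpace ℝ (Fin n)) (hr.trans hrs).le
    exact ⟨y, by simpa [U, hy] using ⟨hrs, hsz⟩⟩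
  rw [setLIntegral_pos_iff hK.measurable]
  refine (hU.measure_pos volume hUne).trans_le (measure_mono fun h hh ↦ ⟨?_, hh.1.le⟩)
  exact (hDec.pos_of_norm_le (norm_pos_iff.1 (hr.trans hh.1)) hh.2.le hKz).ne'

/-! ### Comparison of the weighted measure with Lebesgue measure. -/

section Weight

variable {w : EuclideanSpace ℝ (Fin n) → ℝ}

lemma AdmissibleDensity.isBoundedUnder_abs (hw : AdmissibleDensity w) :
    IsBoundedUnder (· ≤ ·) (ae volume) fun x ↦ |w x| := by
  have h := hw.1.2
  rw [eLpNorm_exponent_top, eLpNormEssSup_lt_top_iff_isBoundedUnder] at h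
  obtain ⟨C, hC⟩ := h
  exact ⟨C, eventually_map.2 ((eventually_map.1 hC).mono fun x hx ↦ by exact_mod_cast hx)⟩

lemma AdmissibleDensity.weightMeasure_le (hw : AdmissibleDensity w) :
    weightMeasure w ≤ ENNReal.ofReal (essSup w volume) • volume := by
  rw [weightMeasure, ← withDensity_const]
  refine withDensity_mono ?_
  have hb : IsBoundedUnder (· ≤ ·) (ae volume) w :=
    (isBoundedUnder_le_abs.1 hw.isBoundedUnder_abs).1
  exact (ae_le_essSup hb).mono fun x hx ↦ ENNReal.ofReal_le_ofReal hx

lemma AdmissibleDensity.le_weightMeasure (hw : AdmissibleDensity w) :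
    ENNReal.ofReal (essInf w volume) • volume ≤ weightMeasure w := by
  rw [weightMeasure, ← withDensity_const]
  refine withDensity_mono ?_
  have hb : IsBoundedUnder (· ≥ ·) (ae volume) w :=
    (isBoundedUnder_le_abs.1 hw.isBoundedUnder_abs).2
  exact (ae_essInf_le hb).mono fun x hx ↦ ENNReal.ofReal_le_ofReal hx

lemma AdmissibleDensity.lintegral_weightMeasure_le (hw : AdmissibleDensity w)
    (s : Set (EuclideanSpace ℝ (Fin n))) (g : EuclideanSpace ℝ (Fin n) → ℝ≥0∞) :
    ∫⁻ x in s, g x ∂weightMeasure w ≤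
      ENNReal.ofReal (essSup w volume) * ∫⁻ x in s, g x := by
  rw [← smul_eq_mul, ← lintegral_smul_measure, ← Measure.restrict_smul]
  exact lintegral_mono' (Measure.restrict_mono le_rfl hw.weightMeasure_le) le_rfl

lemma AdmissibleDensity.le_lintegral_weightMeasure (hw : AdmissibleDensity w)
    (s : Set (EuclideanSpace ℝ (Fin n))) (g : EuclideanSpace ℝ (Fin n) → ℝ≥0∞) :
    ENNReal.ofReal (essInf w volume) * ∫⁻ x in s, g x ≤
      ∫⁻ x in s, g x ∂weightMeasure w := by
  rw [← smul_eq_mul, ← lintegral_smul_measure, ← Measure.restrict_smul]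
  exact lintegral_mono' (Measure.restrict_mono le_rfl hw.le_weightMeasure) le_rfl

end Weight

/-! ### Energy comparison with the zero function. -/

variable {w : EuclideanSpace ℝ (Fin n) → ℝ} {Λ R : ℝ} {c : ℝ≥0∞}

/-- Finite fidelity puts `u - f` in `L¹`, because `w` is bounded below. Hence the Poincaré
inequality, proved for integrable functions, applies to every competitor of finite energy. -/
lemma integrable_of_energy_lt_top (hw : AdmissibleDensity w) (hΛ : 0 < Λ)
    (hf : Integrable f volume) (hu : LocallyIntegrable u volume)
    (h : energy K f Λ (weightMeasure w) u < ∞) : Integrable u volume := by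
  have h1 : ∫⁻ x, ‖u x - f x‖ₑ ∂weightMeasure w < ∞ :=
    ENNReal.lt_top_of_mul_ne_top_right (ENNReal.add_lt_top.1 h).2.ne (by simpa)
  have h2 := hw.le_lintegral_weightMeasure Set.univ fun x ↦ ‖u x - f x‖ₑ
  simp only [Measure.restrict_univ] at h2
  have h3 : ∫⁻ x, ‖u x - f x‖ₑ < ∞ :=
    ENNReal.lt_top_of_mul_ne_top_right (h2.trans_lt h1).ne (by simpa using hw.2)
  have h4 : Integrable (fun x ↦ u x - f x) volume :=
    ⟨hu.aestronglyMeasurable.sub hf.aestronglyMeasurable, h3⟩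
  exact (h4.add hf).congr (.of_forall fun x ↦ by simp)

lemma energy_congr_ae {v : EuclideanSpace ℝ (Fin n) → ℝ} (h : u =ᵐ[volume] v) :
    energy K f Λ (weightMeasure w) u = energy K f Λ (weightMeasure w) v := by
  unfold energy
  rw [kerVariation_congr_ae h]
  congr 2
  refine lintegral_congr_ae ?_
  filter_upwards [(withDensity_absolutelyContinuous _ _).ae_le h] with x hx
  rw [hx]

lemma energy_zero_lt_top (hw : AdmissibleDensity w) (hf : Integrable f volume) :
    energy K f Λ (weightMeasure w) 0 < ∞ := by
  have h2 := hw.lintegral_weightMeasure_le Set.univ fun x ↦ ‖f x‖ₑ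
  simp only [Measure.restrict_univ] at h2
  simpa [energy, kerVariation] using ENNReal.mul_lt_top (ENNReal.ofReal_lt_top (r := Λ))
    (h2.trans_lt (ENNReal.mul_lt_top ENNReal.ofReal_lt_top hf.2))

/-- Comparison of the energies of `0` and of an integrable function, given a Poincaré inequality. -/
lemma energy_zero_add_le (hw : AdmissibleDensity w)
    (hfR : ∀ᵐ x ∂volume, x ∉ ball (0 : EuclideanSpace ℝ (Fin n)) R → f x = 0)
    (hu : AEMeasurable u volume)
    (hc : c * ∫⁻ x in ball 0 R, ‖u x‖ₑ ≤ kerVariation K u) :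
    energy K f Λ (weightMeasure w) 0 + c * (∫⁻ x in ball 0 R, ‖u x‖ₑ) +
        ENNReal.ofReal Λ * ∫⁻ x in (ball 0 R)ᶜ, ‖u x‖ₑ ∂weightMeasure w ≤
      energy K f Λ (weightMeasure w) u +
        ENNReal.ofReal Λ * ENNReal.ofReal (essSup w volume) * ∫⁻ x in ball 0 R, ‖u x‖ₑ := by
  have hac : weightMeasure w ≪ volume := withDensity_absolutelyContinuous _ _
  have hfR' := hac.ae_le hfR
  have hB : MeasurableSet (ball (0 : EuclideanSpace ℝ (Fin n)) R) := measurableSet_ball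
  have hout {g : EuclideanSpace ℝ (Fin n) → ℝ} :
      ∫⁻ x in (ball 0 R)ᶜ, ‖g x - f x‖ₑ ∂weightMeasure w =
        ∫⁻ x in (ball 0 R)ᶜ, ‖g x‖ₑ ∂weightMeasure w := by
    refine setLIntegral_congr_fun_ae hB.compl ?_
    filter_upwards [hfR'] with x hx hxB
    rw [hx hxB, sub_zero]
  -- The triangle inequality `|f| ≤ |u - f| + |u|` inside the ball is the only place where fidelity
  -- is lost.
  have hin : ∫⁻ x in ball 0 R, ‖f x‖ₑ ∂weightMeasure w ≤
      ∫⁻ x in ball 0 R, ‖u x - f x‖ₑ ∂weightMeasure w +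
        ENNReal.ofReal (essSup w volume) * ∫⁻ x in ball 0 R, ‖u x‖ₑ := by
    refine le_trans ?_ (add_le_add_right (hw.lintegral_weightMeasure_le _ _) _)
    rw [← lintegral_add_right' _ ((hu.mono_ac hac).restrict.enorm)]
    refine lintegral_mono fun x ↦ ?_
    simpa [add_comm] using enorm_sub_le (a := u x) (b := u x - f x)
  have e0 : energy K f Λ (weightMeasure w) 0 =
      ENNReal.ofReal Λ * ∫⁻ x in ball 0 R, ‖f x‖ₑ ∂weightMeasure w := by
    have := hout (g := 0)
    simp only [Pi.zero_apply, zero_sub, enorm_neg, enorm_zero, lintegral_zero] at this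
    simp only [energy, kerVariation, Pi.zero_apply, sub_self, zero_sub, enorm_neg, enorm_zero,
      zero_mul, lintegral_zero, mul_zero, zero_add]
    rw [← lintegral_add_compl (fun x ↦ ‖f x‖ₑ) hB, this, add_zero]
  rw [e0, energy, ← lintegral_add_compl (fun x ↦ ‖u x - f x‖ₑ) hB, hout]
  calc _ ≤ ENNReal.ofReal Λ * (∫⁻ x in ball 0 R, ‖u x - f x‖ₑ ∂weightMeasure w +
          ENNReal.ofReal (essSup w volume) * ∫⁻ x in ball 0 R, ‖u x‖ₑ) + kerVariation K u +
          ENNReal.ofReal Λ * ∫⁻ x in (ball 0 R)ᶜ, ‖u x‖ₑ ∂weightMeasure w := by gcongr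
    _ = _ := by ring

lemma energy_zero_le (hw : AdmissibleDensity w)
    (hfR : ∀ᵐ x ∂volume, x ∉ ball (0 : EuclideanSpace ℝ (Fin n)) R → f x = 0)
    (hu : Integrable u volume)
    (hc : c * ∫⁻ x in ball 0 R, ‖u x‖ₑ ≤ kerVariation K u)
    (hΛc : ENNReal.ofReal Λ * ENNReal.ofReal (essSup w volume) < c) :
    energy K f Λ (weightMeasure w) 0 ≤ energy K f Λ (weightMeasure w) u := by
  have ha : ∫⁻ x in ball 0 R, ‖u x‖ₑ ≠ ∞ := hu.restrict.2.ne
  have h := le_self_add.trans (energy_zero_add_le (Λ := Λ) hw hfR hu.1.aemeasurable hc)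
  have h' : c * ∫⁻ x in ball 0 R, ‖u x‖ₑ ≥
    ENNReal.ofReal Λ * ENNReal.ofReal (essSup w volume) * ∫⁻ x in ball 0 R, ‖u x‖ₑ := by gcongr
  refine (ENNReal.add_le_add_iff_right
    (ENNReal.mul_ne_top (ENNReal.mul_ne_top ENNReal.ofReal_ne_top ENNReal.ofReal_ne_top) ha)).1
    (le_trans ?_ h)
  gcongr

lemma ae_eq_zero_of_energy_le (hw : AdmissibleDensity w) (hf : Integrable f volume)
    (hfR : ∀ᵐ x ∂volume, x ∉ ball (0 : EuclideanSpace ℝ (Fin n)) R → f x = 0)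
    (hu : Integrable u volume)
    (hc : c * ∫⁻ x in ball 0 R, ‖u x‖ₑ ≤ kerVariation K u) (hΛ : 0 < Λ)
    (hΛc : ENNReal.ofReal Λ * ENNReal.ofReal (essSup w volume) < c)
    (hle : energy K f Λ (weightMeasure w) u ≤ energy K f Λ (weightMeasure w) 0) :
    u =ᵐ[volume] 0 := by
  have ha : ∫⁻ x in ball 0 R, ‖u x‖ₑ ≠ ∞ := hu.restrict.2.ne
  have h := (energy_zero_add_le (Λ := Λ) hw hfR hu.1.aemeasurable hc).trans
    (add_le_add_left hle _)
  -- Cancelling the finite energy of `0` leaves `c * a + Λ * b ≤ Λ * essSup w * a`, with `a` the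
  -- mass of `u` inside the ball and `b` its weighted mass outside. The strict bound on `Λ` forces
  -- `a = 0`, and then `b = 0`.
  rw [add_assoc, ENNReal.add_le_add_iff_left (energy_zero_lt_top hw hf).ne] at h
  have ha0 : ∫⁻ x in ball 0 R, ‖u x‖ₑ = 0 := by
    by_contra ha0
    exact ((ENNReal.mul_lt_mul_iff_left ha0 ha).2 hΛc).not_ge (le_self_add.trans h)
  have hb0 : ∫⁻ x in (ball 0 R)ᶜ, ‖u x‖ₑ = 0 := by
    have h0 : ∫⁻ x in (ball 0 R)ᶜ, ‖u x‖ₑ ∂weightMeasure w = 0 := by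
      simpa [ha0, hΛ.not_ge] using h
    have := (hw.le_lintegral_weightMeasure _ _).trans h0.le
    simpa [hw.2.not_ge] using this
  have h0 : ∫⁻ x, ‖u x‖ₑ = 0 := by
    rw [← lintegral_add_compl _ (measurableSet_ball (x := 0) (ε := R)), ha0, hb0, add_zero]
  exact ((lintegral_eq_zero_iff' hu.1.aemeasurable.enorm).1 h0).mono fun x hx ↦ by simpa using hx

lemma solutions_eq_zero (hK : Measurable K) (hw : AdmissibleDensity w) (hf : Integrable f volume)
    (hfR : ∀ᵐ x ∂volume, x ∉ ball (0 : EuclideanSpace ℝ (Fin n)) R → f x = 0) (hΛ : 0 < Λ)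
    (hΛK : ENNReal.ofReal Λ * ENNReal.ofReal (essSup w volume) <
      2⁻¹ * ∫⁻ h in {h | 2 * R ≤ ‖h‖}, K h) :
    solutions K f Λ (weightMeasure w) = {u | u =ᵐ[volume] 0} := by
  have hP {u} (hu : Integrable u volume) :=
    lintegral_kernel_mul_setLIntegral_ball_le_kerVariation hK hu R
  ext u
  constructor
  · rintro ⟨hu, hfin, hmin⟩
    have hui := integrable_of_energy_lt_top hw hΛ hf hu hfin
    exact ae_eq_zero_of_energy_le hw hf hfR hui (hP hui) hΛ hΛK
      (hmin 0 (locallyIntegrable_zero))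
  · intro (hu : u =ᵐ[volume] 0)
    refine ⟨((integrable_zero _ _ _).congr hu.symm).locallyIntegrable, ?_, fun v hv ↦ ?_⟩
    · rw [energy_congr_ae hu]
      exact energy_zero_lt_top hw hf
    · rw [energy_congr_ae hu]
      rcases eq_or_ne (energy K f Λ (weightMeasure w) v) ∞ with h | h
      · rw [h]; exact le_top
      · have hvi := integrable_of_energy_lt_top hw hΛ hf hv h.lt_top
        exact energy_zero_le hw hfR hvi (hP hvi) hΛK

end

end NonlocalTV

theorem mainTheorem11 (n : ℕ) (hn : 1 ≤ n)
    (K : EuclideanSpace ℝ (Fin n) → ℝ≥0∞) (hK : NonlocalTV.IsKernel K)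
    (hRad : NonlocalTV.Radial K) (hNts : NonlocalTV.NotTooSingular K)
    (hNint : NonlocalTV.NotIntegrable K) (hDec : NonlocalTV.Decreasing 1 K)
    (D : ℝ≥0∞) (hDou : NonlocalTV.Doubling D K)
    (R : ℝ) (hR : 0 < R) (hRD : ENNReal.ofReal R < D / 4) (wbar : ℝ) :
    ∃ Λ₀ : ℝ, 0 < Λ₀ ∧
      ∀ w : EuclideanSpace ℝ (Fin n) → ℝ, NonlocalTV.AdmissibleDensity w →
        essSup w volume = wbar →
      ∀ f : EuclideanSpace ℝ (Fin n) → ℝ, Integrable f volume →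
        (∀ᵐ x ∂volume, x ∉ Metric.ball (0 : EuclideanSpace ℝ (Fin n)) R → f x = 0) →
      ∀ Λ : ℝ, 0 < Λ → Λ < Λ₀ →
        NonlocalTV.solutions K f Λ (NonlocalTV.weightMeasure w) = {u | u =ᵐ[volume] 0} := by
  have hRD' : ENNReal.ofReal (2 * R) ≤ 2 * D := by
    rw [ENNReal.ofReal_mul zero_le_two, ENNReal.ofReal_ofNat]
    gcongr
    exact hRD.le.trans (ENNReal.div_le_of_le_mul (le_mul_of_one_le_right' (by norm_num)))
  have hpos : 0 < 2⁻¹ * ∫⁻ h in {h | 2 * R ≤ ‖h‖}, K h :=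
    ENNReal.mul_pos (by simp) (NonlocalTV.setLIntegral_kernel_pos hn hK hDec hDou
      (by positivity) hRD').ne'
  -- Any positive real below the Poincaré constant serves, so finiteness of the tail integral is not
  -- needed.
  obtain ⟨c, hc0, hcK⟩ := ENNReal.lt_iff_exists_real_btwn.1 hpos
  have hc : 0 < c := ENNReal.ofReal_pos.1 hcK.1
  -- `wbar` is an arbitrary real here; `|wbar| + 1` is a positive denominator that dominates it.
  refine ⟨c / (|wbar| + 1), by positivity, fun w hw hwbar f hf hfR Λ hΛ hΛc ↦ ?_⟩
  refine NonlocalTV.solutions_eq_zero hK.measurable hw hf hfR hΛ (lt_of_le_of_lt ?_ hcK.2)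
  rw [hwbar, ← ENNReal.ofReal_mul hΛ.le]
  refine ENNReal.ofReal_le_ofReal ?_
  rw [lt_div_iff₀ (by positivity)] at hΛc
  nlinarith [le_abs_self wbar]
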